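/- All manifolds, maps and tensors are smooth. For an isometric immersion $f\colon M^m\to\mathbb{R}^k$ of a Riemannian manifold, let $\alpha_f(X,Y)$ be its second fundamental form, $A_\xi$ its shape operators, $\langle A_\xi X,Y\rangle=\langle\alpha_f(X,Y),\xi\rangle$, and $$III_f(X,Y)=\sum_{i=1}^m\langle\alpha_f(X,X_i),\alpha_f(Y,X_i)\rangle,\qquad (X_i)\text{ an orthonormal basis of }T_xM,$$ its third fundamental form. Its Gauss map $\phi_f\colon M\to Gr_m(\mathbb{R}^k)$ is $x\mapsto f_*T_xM$, where the Grassmannian carries its standard symmetric metric (in terms of orthogonal projections, $\langle S,T\rangle=\tfrac12\operatorname{tr}(ST)$). Isometric immersions $f,g\colon M^m\to\mathbb{R}^k$ are said to have isometric Gauss maps if the graphs $M\to M\times Gr_m(\mathbb{R}^k)$ of $\phi_f$ and $\phi_g$ induce the same metric on $M$. An isometric immersion $F\colon N^m\to\mathbb{R}^{m+1}$, $m\ge 3$, is a Sbrana--Cartan hypersurface if it has rank two, i.e. its relative nullity $\Delta=\{X:\alpha_F(X,\cdot)=0\}$ has dimension $m-2$ everywhere, and $N$ admits an isometric immersion into $\mathbb{R}^{m+1}$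 that is not congruent to $F$. It is surface-like if it is (locally) a cylinder over a surface in $\mathbb{R}^3$, or a cylinder over the cone of a surface in $\mathbb{S}^3\subset\mathbb{R}^4$. A Sbrana--Cartan hypersurface is elliptic if it is not surface-like and there is a tensor $J\in\Gamma(\operatorname{End}(\Delta^\perp))$ with $J^2=-I$ such that, for all $T\in\Gamma(\Delta)$, $\nabla_TJ=0$ and the splitting tensor $C_TX=-(\nabla_XT)_{\Delta^\perp}$ lies in $\operatorname{span}\{I,J\}$ at every point. **Proposition.** Let $n\ge 3$, let $F\colon\bar M^{n+1}\to\mathbb{R}^{n+2}$ be an elliptic Sbrana--Cartan hypersurface and let $G\colon\bar M^{n+1}\to\mathbb{R}^{n+2}$ be an isometric immersion of the same Riemannian manifold. Let $j\colon M^n\to\bar M^{n+1}$ be an isometric immersion such that at every point of $M^n$ $$\operatorname{tr}\big((A^F|_{j_*TM})_{j_*TM}\big)=\operatorname{tr}\big((A^G|_{j_*TM})_{j_*TM}\big)=0,$$ where $A^F,A^G$ are the shape operators of $F,G$ with respect to (either choice of) unit normal vectors and $(\cdot)_{j_*TM}$ is the orthogonal projection onto $j_*TM$. Then $f=F\circ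 j$ and $g=G\circ j$ have isometric Gauss maps, and $III_f=III_g$. -/

import Mathlib

open Bundle Manifold Filter
open scoped ContDiff Topology InnerProductSpace

noncomputable section

namespace GaussMaps

/-- Euclidean space `ℝᵐ`. -/
abbrev E (m : ℕ) : Type := EuclideanSpace ℝ (Fin m)

section Immersions

variable (m k : ℕ)
  {M : Type*} [TopologicalSpace M] [ChartedSpace (E m) M]
  {N : Type*} [TopologicalSpace N] [ChartedSpace (E k) N]

instance instFiniteDimensionalTangentSpace (x : M) :
    FiniteDimensional ℝ (TangentSpace (𝓡 m) x) :=
  inferInstanceAs (FiniteDimensional ℝ (E m))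

/-- A smooth isometric immersion between Riemannian manifolds (preservation of the metric makes
the differentials injective). -/
structure IsIsometricImmersion
    [IsManifold (𝓡 m) ∞ M] [IsManifold (𝓡 k) ∞ N]
    [RiemannianBundle (fun x : M => TangentSpace (𝓡 m) x)]
    [RiemannianBundle (fun y : N => TangentSpace (𝓡 k) y)] (f : M → N) : Prop where
  contMDiff : ContMDiff (𝓡 m) (𝓡 k) ∞ f
  inner_map : ∀ (x : M) (X Y : TangentSpace (𝓡 m) x),
    ⟪mfderiv (𝓡 m) (𝓡 k) f x X, mfderiv (𝓡 m) (𝓡 k) f x Y⟫_ℝ = ⟪X, Y⟫_ℝ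

/-- The subspace `f_* T_x M` of `ℝᵏ`. -/
def tangentImage (f : M → E k) (x : M) : Submodule ℝ (E k) :=
  LinearMap.range (mvfderiv (𝓡 m) f x : TangentSpace (𝓡 m) x →ₗ[ℝ] E k)

/-- The second fundamental form `α_f(X, Y)` at `x` of an immersion `f : Mᵐ → ℝᵏ`: the component
normal to `f_* T_x M` of the second derivative of `f` in a chart around `x`. -/
def secondFF (f : M → E k) (x : M) :
    TangentSpace (𝓡 m) x →ₗ[ℝ] TangentSpace (𝓡 m) x →ₗ[ℝ] E k :=
  let φ := extChartAt (𝓡 m) x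
  let dφ : TangentSpace (𝓡 m) x →ₗ[ℝ] E m := mvfderiv (𝓡 m) φ x
  let hess : E m →ₗ[ℝ] E m →ₗ[ℝ] E k :=
    (fderiv ℝ (fderiv ℝ (f ∘ φ.symm)) (φ x)).toLinearMap₁₂
  (hess.compl₁₂ dφ dφ).compr₂ ((tangentImage m k f x)ᗮ.starProjection : E k →ₗ[ℝ] E k)

/-- The relative nullity subspace `Δ(x) = {X | α_f(X, Y) = 0 for all Y}`. -/
def relativeNullity (f : M → E k) (x : M) : Submodule ℝ (TangentSpace (𝓡 m) x) :=
  LinearMap.ker (secondFF m k f x)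

variable [IsManifold (𝓡 m) ∞ M] [RiemannianBundle (fun x : M => TangentSpace (𝓡 m) x)]

/-- The shape operator `A_ξ` of `f` at `x`, characterized by
`⟪A_ξ X, Y⟫ = ⟪α_f(X, Y), ξ⟫`. -/
def shapeOperator (f : M → E k) (x : M) (ξ : E k) :
    TangentSpace (𝓡 m) x →ₗ[ℝ] TangentSpace (𝓡 m) x where
  toFun X := LinearMap.adjoint (secondFF m k f x X) ξ
  map_add' X Y := by simp
  map_smul' c X := by simp

/-- The third fundamental form
`III_f(X, Y) = ∑ᵢ ⟪α_f(X, Xᵢ), α_f(Y, Xᵢ)⟫`, `(Xᵢ)` an orthonormal basis of `T_x M`. -/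
def thirdFF (f : M → E k) (x : M) (X Y : TangentSpace (𝓡 m) x) : ℝ :=
  let b := stdOrthonormalBasis ℝ (TangentSpace (𝓡 m) x)
  ∑ i, ⟪secondFF m k f x X (b i), secondFF m k f x Y (b i)⟫_ℝ

/-- The Gauss map `x ↦ f_* T_x M`. A point of the Grassmannian is represented, as usual, by the
orthogonal projection onto the subspace. -/
def gaussMap (f : M → E k) (x : M) : E k →L[ℝ] E k :=
  (tangentImage m k f x).starProjection

/-- The metric induced on `M` by the graph `M → M × Gr_m(ℝᵏ)` of the Gauss map. The standard
symmetric metric of the Grassmannian is, in terms of orthogonal projections,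
`⟨S, T⟩ = (1/2) tr (S T)`. -/
def gaussGraphMetric (f : M → E k) (x : M) (X Y : TangentSpace (𝓡 m) x) : ℝ :=
  ⟪X, Y⟫_ℝ + (1 / 2) * LinearMap.trace ℝ (E k)
    ((mvfderiv (𝓡 m) (gaussMap m k f) x X : E k →L[ℝ] E k) ∘L
      (mvfderiv (𝓡 m) (gaussMap m k f) x Y : E k →L[ℝ] E k) : E k →L[ℝ] E k)

/-- `f` and `g` have isometric Gauss maps: the graphs of the two Gauss maps induce the same
metric on `M`. -/
def HaveIsometricGaussMaps (f g : M → E k) : Prop :=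
  ∀ (x : M) (X Y : TangentSpace (𝓡 m) x), gaussGraphMetric m k f x X Y = gaussGraphMetric m k g x X Y

/-- `f` and `g` have the same third fundamental form. -/
def HaveEqualThirdFF (f g : M → E k) : Prop :=
  ∀ (x : M) (X Y : TangentSpace (𝓡 m) x), thirdFF m k f x X Y = thirdFF m k g x X Y

/-- The endomorphism `X ↦ (A X)_W` of a subspace `W`. -/
def compression {T : Type*} [NormedAddCommGroup T] [InnerProductSpace ℝ T]
    [FiniteDimensional ℝ T] (W : Submodule ℝ T) (A : T →ₗ[ℝ] T) : W →ₗ[ℝ] W :=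
  (W.orthogonalProjectionOnto : T →ₗ[ℝ] W) ∘ₗ A ∘ₗ W.subtype

/-- The component `X_{W^⊥}` of a vector orthogonal to a subspace `W`. -/
def orthComponent {T : Type*} [NormedAddCommGroup T] [InnerProductSpace ℝ T]
    [FiniteDimensional ℝ T] (W : Submodule ℝ T) (X : T) : T :=
  Wᗮ.starProjection X

/-! ### Elliptic Sbrana-Cartan hypersurfaces -/

/-- The Levi-Civita derivative `∇_X Y` at `x` of a vector field `Y`, for the metric induced by an
isometric immersion `f`: `f_* ∇_X Y` is the tangential component of the Euclidean derivative of
`f_* Y` in the direction `X` (the adjoint of `f_*` is the tangential projection followed by the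
inverse of `f_*`). -/
def covDeriv (f : M → E k) (Y : ∀ y : M, TangentSpace (𝓡 m) y) (x : M)
    (X : TangentSpace (𝓡 m) x) : TangentSpace (𝓡 m) x :=
  LinearMap.adjoint (mvfderiv (𝓡 m) f x : TangentSpace (𝓡 m) x →ₗ[ℝ] E k)
    (mvfderiv (𝓡 m) (fun y => mvfderiv (𝓡 m) f y (Y y)) x X)

/-- The vector field `Y` is smooth at `x`. -/
def SmoothFieldAt (Y : ∀ y : M, TangentSpace (𝓡 m) y) (x : M) : Prop :=
  ContMDiffAt (𝓡 m) (𝓡 m).tangent ∞ (fun y => (⟨y, Y y⟩ : TangentBundle (𝓡 m) M)) x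

/-- The component of `∇_X Y` orthogonal to the relative nullity of `f`. -/
def horCovDeriv (f : M → E k) (Y : ∀ y : M, TangentSpace (𝓡 m) y) (x : M)
    (X : TangentSpace (𝓡 m) x) : TangentSpace (𝓡 m) x :=
  orthComponent (relativeNullity m k f x) (covDeriv m k f Y x X)

/-- `J` is a smooth tensor on `Δ^⊥` (extended by zero to `Δ`) with `J² = -I`, parallel along the
relative nullity `Δ` of `f`, and such that every splitting tensor
`C_T X = -(∇_X T)_{Δ^⊥}`, `T ∈ Γ(Δ)`, lies in `span {I, J}`. -/
structure IsEllipticTensor (f : M → E k)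
    (J : ∀ x : M, TangentSpace (𝓡 m) x →ₗ[ℝ] TangentSpace (𝓡 m) x) : Prop where
  map_nullity : ∀ x, ∀ T ∈ relativeNullity m k f x, J x T = 0
  map_mem : ∀ x X, J x X ∈ (relativeNullity m k f x)ᗮ
  sq : ∀ x, ∀ X ∈ (relativeNullity m k f x)ᗮ, J x (J x X) = -X
  smooth : ∀ (x : M) (Y : ∀ y : M, TangentSpace (𝓡 m) y),
    SmoothFieldAt m Y x → SmoothFieldAt m (fun y => J y (Y y)) x
  parallel : ∀ (x : M) (Y : ∀ y : M, TangentSpace (𝓡 m) y), SmoothFieldAt m Y x →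
    (∀ᶠ y in 𝓝 x, Y y ∈ (relativeNullity m k f y)ᗮ) → ∀ T ∈ relativeNullity m k f x,
      horCovDeriv m k f (fun y => J y (Y y)) x T = J x (horCovDeriv m k f Y x T)
  splitting : ∀ (x : M) (T : ∀ y : M, TangentSpace (𝓡 m) y), SmoothFieldAt m T x →
    (∀ᶠ y in 𝓝 x, T y ∈ relativeNullity m k f y) →
      ∃ a b : ℝ, ∀ X ∈ (relativeNullity m k f x)ᗮ, -horCovDeriv m k f T x X = a • X + b • J x X

end Immersions

section Hypersurfaces

variable (m : ℕ) {M : Type*} [TopologicalSpace M] [ChartedSpace (E m) M]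

/-- Near `x`, the hypersurface `F` is a cylinder over a surface `h` in a Euclidean space
`W = ℝ³ ⊆ ℝᵐ⁺¹`. -/
def IsCylinderOverSurfaceAt (F : M → E (m + 1)) (x : M) : Prop :=
  ∃ (W : Submodule ℝ (E (m + 1))) (U : Set M) (D : Set (E 2)) (h : E 2 → E (m + 1))
    (q : M → E 2) (w : M → E (m + 1)),
    Module.finrank ℝ W = 3 ∧ IsOpen U ∧ x ∈ U ∧ IsOpen D ∧
    ContDiffOn ℝ ∞ h D ∧ (∀ u ∈ D, h u ∈ W ∧ Function.Injective (fderiv ℝ h u)) ∧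
    ContMDiffOn (𝓡 m) (𝓡 2) ∞ q U ∧ ContMDiffOn (𝓡 m) (𝓡 (m + 1)) ∞ w U ∧
    ∀ y ∈ U, q y ∈ D ∧ w y ∈ Wᗮ ∧ F y = h (q y) + w y

/-- Near `x`, the hypersurface `F` is a cylinder over the cone, with some vertex `p`, of a surface
`h` in the unit sphere `𝕊³` of a Euclidean space `W = ℝ⁴ ⊆ ℝᵐ⁺¹`. -/
def IsCylinderOverConeAt (F : M → E (m + 1)) (x : M) : Prop :=
  ∃ (W : Submodule ℝ (E (m + 1))) (p : E (m + 1)) (U : Set M) (D : Set (E 2))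
    (h : E 2 → E (m + 1)) (q : M → E 2) (t : M → ℝ) (w : M → E (m + 1)),
    Module.finrank ℝ W = 4 ∧ IsOpen U ∧ x ∈ U ∧ IsOpen D ∧
    ContDiffOn ℝ ∞ h D ∧
    (∀ u ∈ D, h u ∈ W ∧ ‖h u‖ = 1 ∧ Function.Injective (fderiv ℝ h u)) ∧
    ContMDiffOn (𝓡 m) (𝓡 2) ∞ q U ∧ ContMDiffOn (𝓡 m) 𝓘(ℝ, ℝ) ∞ t U ∧
    ContMDiffOn (𝓡 m) (𝓡 (m + 1)) ∞ w U ∧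
    ∀ y ∈ U, q y ∈ D ∧ 0 < t y ∧ w y ∈ Wᗮ ∧ F y = p + t y • h (q y) + w y

/-- Surface-like hypersurfaces. -/
def IsSurfaceLike (F : M → E (m + 1)) : Prop :=
  (∀ x, IsCylinderOverSurfaceAt m F x) ∨ (∀ x, IsCylinderOverConeAt m F x)

variable [IsManifold (𝓡 m) ∞ M] [RiemannianBundle (fun x : M => TangentSpace (𝓡 m) x)]

/-- A Sbrana-Cartan hypersurface: an isometric immersion of rank two everywhere that admits
an isometric immersion of the same Riemannian manifold not congruent to it. -/
structure IsSbranaCartan (F : M → E (m + 1)) : Prop where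
  isometric : IsIsometricImmersion m (m + 1) F
  rank_two : ∀ x, Module.finrank ℝ (relativeNullity m (m + 1) F x) + 2 = m
  deformable : ∃ G : M → E (m + 1), IsIsometricImmersion m (m + 1) G ∧
    ¬ ∃ τ : E (m + 1) ≃ᵢ E (m + 1), ∀ x, G x = τ (F x)

/-- A Sbrana-Cartan hypersurface of elliptic type: it is not surface-like, and the tensor `J` on
`Δ^⊥` associated with it satisfies `J² = -I`. -/
structure IsEllipticSbranaCartan (F : M → E (m + 1)) : Prop extends IsSbranaCartan m F where
  not_surfaceLike : ¬ IsSurfaceLike m F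
  exists_tensor : ∃ J : ∀ x : M, TangentSpace (𝓡 m) x →ₗ[ℝ] TangentSpace (𝓡 m) x,
    IsEllipticTensor m (m + 1) F J

end Hypersurfaces

end GaussMaps

end

/-!
Let `b` be an orthonormal basis of `TₓM` and `H_f = ∑ᵢ α_f(bᵢ, bᵢ)`. Contracting the Gauss
equation gives `III_f(X, Y) = ⟪H_f, α_f(X, Y)⟫ - Ric(X, Y)`, so `III_f = III_g` amounts to
`⟪H_f, α_f(X, Y)⟫ = ⟪H_g, α_g(X, Y)⟫`. For `f = F ∘ j`, the component of `α_f(X, Y)` normal to `F`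
is `α_F(j_*X, j_*Y)` and the component tangent to `F` is the image under `F_*` of the second
fundamental form of `j`. The trace condition on the shape operators of `F` makes the normal
component of `H_f` vanish, so only the tangent components enter into `⟪H_f, α_f(X, Y)⟫`, and these
are intrinsic to `j`.

Differentiating the orthogonal projection onto `f_*TM` in the direction `X` gives a self-adjoint
map that exchanges tangent and normal spaces and sends `f_*Y` to `α_f(X, Y)`; hence the graph of
the Gauss map induces the metric `⟪X, Y⟫ + III_f(X, Y)` on `M`.
-/

namespace GaussMaps

section ChainRule

variable {𝕜 U V H : Type*} [NontriviallyNormedField 𝕜] [NormedAddCommGroup U] [NormedSpace 𝕜 U]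
  [NormedAddCommGroup V] [NormedSpace 𝕜 V] [NormedAddCommGroup H] [NormedSpace 𝕜 H]

theorem fderiv_clm_apply_const {c : V → U →L[𝕜] H} {p : V} (hc : DifferentiableAt 𝕜 c p)
    (u : V) (w : U) : fderiv 𝕜 (fun y => c y w) p u = fderiv 𝕜 c p u w := by
  simp [fderiv_clm_apply hc (differentiableAt_const w)]

theorem fderiv_fderiv_comp {F : V → H} {j : U → V} {p : U} (hF : ContDiffAt 𝕜 2 F (j p))
    (hj : ContDiffAt 𝕜 2 j p) (u v : U) :
    fderiv 𝕜 (fderiv 𝕜 (F ∘ j)) p u v =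
      fderiv 𝕜 (fderiv 𝕜 F) (j p) (fderiv 𝕜 j p u) (fderiv 𝕜 j p v) +
        fderiv 𝕜 F (j p) (fderiv 𝕜 (fderiv 𝕜 j) p u v) := by
  have chain_rule : fderiv 𝕜 (F ∘ j) =ᶠ[𝓝 p] fun y => fderiv 𝕜 F (j y) ∘L fderiv 𝕜 j y := by
    filter_upwards [hj.continuousAt.eventually (hF.eventually (by simp)), hj.eventually (by simp)]
      with y hFy hjy
    exact fderiv_comp y (hFy.differentiableAt two_ne_zero) (hjy.differentiableAt two_ne_zero)
  have hF' : DifferentiableAt 𝕜 (fderiv 𝕜 F) (j p) :=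
    (hF.fderiv_right (m := 1) one_add_one_eq_two.le).differentiableAt one_ne_zero
  have hj' : DifferentiableAt 𝕜 (fderiv 𝕜 j) p :=
    (hj.fderiv_right (m := 1) one_add_one_eq_two.le).differentiableAt one_ne_zero
  have hFj : HasFDerivAt (fun y => fderiv 𝕜 F (j y)) _ p :=
    hF'.hasFDerivAt.comp p (hj.differentiableAt two_ne_zero).hasFDerivAt
  rw [chain_rule.fderiv_eq, (hFj.clm_comp hj'.hasFDerivAt).fderiv]
  simp [add_comm]

end ChainRule

theorem fderiv_fderiv_comm {V H : Type*} [NormedAddCommGroup V] [NormedSpace ℝ V]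
    [NormedAddCommGroup H] [NormedSpace ℝ H] {f : V → H} {p : V} (hf : ContDiffAt ℝ 2 f p)
    (u v : V) : fderiv ℝ (fderiv ℝ f) p u v = fderiv ℝ (fderiv ℝ f) p v u :=
  (hf.isSymmSndFDerivAt (by simp)).eq u v

section TheoremaEgregium

variable {V H H' : Type*} [NormedAddCommGroup V] [NormedSpace ℝ V]
  [NormedAddCommGroup H] [InnerProductSpace ℝ H] [NormedAddCommGroup H'] [InnerProductSpace ℝ H']
  {f : V → H} {g : V → H'} {p : V}

/-- The metric induced at `p` by a map `f` into a Euclidean space. -/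
noncomputable def inducedMetric (f : V → H) (p u v : V) : ℝ :=
  ⟪fderiv ℝ f p u, fderiv ℝ f p v⟫_ℝ

/-- The Christoffel symbols of the first kind `Γ(u, v; w) = ⟪∇_u v, w⟫` of the metric induced by
`f`, where `u`, `v`, `w` are extended to constant vector fields. -/
noncomputable def christoffel (f : V → H) (p u v w : V) : ℝ :=
  ⟪fderiv ℝ (fderiv ℝ f) p u v, fderiv ℝ f p w⟫_ℝ

theorem fderiv_inducedMetric (hf : ContDiffAt ℝ 2 f p) (u v w : V) :
    fderiv ℝ (fun y => inducedMetric f y v w) p u =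
      christoffel f p u v w + christoffel f p u w v := by
  have hf' : DifferentiableAt ℝ (fderiv ℝ f) p :=
    (hf.fderiv_right (m := 1) one_add_one_eq_two.le).differentiableAt one_ne_zero
  simp only [inducedMetric]
  rw [fderiv_inner_apply ℝ (hf'.clm_apply (differentiableAt_const v))
    (hf'.clm_apply (differentiableAt_const w)), fderiv_clm_apply_const hf',
    fderiv_clm_apply_const hf', real_inner_comm, add_comm]
  rfl

theorem christoffel_comm (hf : ContDiffAt ℝ 2 f p) (u v w : V) :
    christoffel f p u v w = christoffel f p v u w := by
  rw [christoffel, christoffel, fderiv_fderiv_comm hf]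

theorem two_mul_christoffel (hf : ContDiffAt ℝ 2 f p) (u v w : V) :
    2 * christoffel f p u v w = fderiv ℝ (fun y => inducedMetric f y v w) p u +
      fderiv ℝ (fun y => inducedMetric f y u w) p v -
      fderiv ℝ (fun y => inducedMetric f y u v) p w := by
  simp only [fderiv_inducedMetric hf]
  linarith [christoffel_comm hf u v w, christoffel_comm hf u w v, christoffel_comm hf v w u]

theorem christoffel_eq_of_inducedMetric_eq (hf : ContDiffAt ℝ 2 f p) (hg : ContDiffAt ℝ 2 g p)
    (h : inducedMetric f =ᶠ[𝓝 p] inducedMetric g) : christoffel f p = christoffel g p := by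
  have hd (v w : V) : fderiv ℝ (fun y => inducedMetric f y v w) p =
      fderiv ℝ (fun y => inducedMetric g y v w) p :=
    EventuallyEq.fderiv_eq (h.mono fun y hy => congrFun₂ hy v w)
  funext u v w
  refine mul_left_cancel₀ (two_ne_zero' ℝ) ?_
  simp only [two_mul_christoffel hf, two_mul_christoffel hg, hd]

theorem fderiv_christoffel (hf : ContDiffAt ℝ 3 f p) (u v w z : V) :
    fderiv ℝ (fun y => christoffel f y u v w) p z =
      ⟪fderiv ℝ (fderiv ℝ (fderiv ℝ f)) p z u v, fderiv ℝ f p w⟫_ℝ +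
        ⟪fderiv ℝ (fderiv ℝ f) p u v, fderiv ℝ (fderiv ℝ f) p z w⟫_ℝ := by
  have hf₁ : ContDiffAt ℝ 2 (fderiv ℝ f) p := hf.fderiv_right two_add_one_eq_three.le
  have hf' : DifferentiableAt ℝ (fderiv ℝ f) p := hf₁.differentiableAt two_ne_zero
  have hf'' : DifferentiableAt ℝ (fderiv ℝ (fderiv ℝ f)) p :=
    (hf₁.fderiv_right (m := 1) one_add_one_eq_two.le).differentiableAt one_ne_zero
  have hfu : DifferentiableAt ℝ (fun y => fderiv ℝ (fderiv ℝ f) y u) p :=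
    hf''.clm_apply (differentiableAt_const u)
  simp only [christoffel]
  rw [fderiv_inner_apply ℝ (hfu.clm_apply (differentiableAt_const v))
    (hf'.clm_apply (differentiableAt_const w)), fderiv_clm_apply_const hf',
    fderiv_clm_apply_const hfu, fderiv_clm_apply_const hf'', add_comm]

theorem inner_fderiv_fderiv_sub_eq_fderiv_christoffel_sub (hf : ContDiffAt ℝ 3 f p)
    (u v w z : V) :
    ⟪fderiv ℝ (fderiv ℝ f) p u v, fderiv ℝ (fderiv ℝ f) p z w⟫_ℝ -
        ⟪fderiv ℝ (fderiv ℝ f) p z v, fderiv ℝ (fderiv ℝ f) p u w⟫_ℝ =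
      fderiv ℝ (fun y => christoffel f y u v w) p z -
        fderiv ℝ (fun y => christoffel f y z v w) p u := by
  have hf₁ : ContDiffAt ℝ 2 (fderiv ℝ f) p := hf.fderiv_right two_add_one_eq_three.le
  rw [fderiv_christoffel hf, fderiv_christoffel hf, fderiv_fderiv_comm hf₁ z u]
  ring

theorem inner_fderiv_fderiv_sub_eq_of_inducedMetric_eq (hf : ContDiffAt ℝ 3 f p)
    (hg : ContDiffAt ℝ 3 g p) (h : inducedMetric f =ᶠ[𝓝 p] inducedMetric g) (u v w z : V) :
    ⟪fderiv ℝ (fderiv ℝ f) p u v, fderiv ℝ (fderiv ℝ f) p z w⟫_ℝ -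
        ⟪fderiv ℝ (fderiv ℝ f) p z v, fderiv ℝ (fderiv ℝ f) p u w⟫_ℝ =
      ⟪fderiv ℝ (fderiv ℝ g) p u v, fderiv ℝ (fderiv ℝ g) p z w⟫_ℝ -
        ⟪fderiv ℝ (fderiv ℝ g) p z v, fderiv ℝ (fderiv ℝ g) p u w⟫_ℝ := by
  have two_le_three : (2 : WithTop ℕ∞) ≤ 3 := by norm_num
  have hΓ : christoffel f =ᶠ[𝓝 p] christoffel g := by
    filter_upwards [h.eventuallyEq_nhds, hf.eventually (by simp), hg.eventually (by simp)]
      with y hy hfy hgy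
    exact christoffel_eq_of_inducedMetric_eq (hfy.of_le two_le_three) (hgy.of_le two_le_three) hy
  have hd (u v w : V) : fderiv ℝ (fun y => christoffel f y u v w) p =
      fderiv ℝ (fun y => christoffel g y u v w) p :=
    EventuallyEq.fderiv_eq (hΓ.mono fun y hy => congrFun (congrFun₂ hy u v) w)
  simp only [inner_fderiv_fderiv_sub_eq_fderiv_christoffel_sub hf,
    inner_fderiv_fderiv_sub_eq_fderiv_christoffel_sub hg, hd]

end TheoremaEgregium

section LinearAlgebra

variable {V H H' : Type*} [NormedAddCommGroup V] [InnerProductSpace ℝ V]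
  [NormedAddCommGroup H] [InnerProductSpace ℝ H] [NormedAddCommGroup H'] [InnerProductSpace ℝ H']

theorem inner_eq_inner_of_mem_range {L : V →ₗᵢ[ℝ] H} {L' : V →ₗᵢ[ℝ] H'} {a b : H} {a' b' : H'}
    (ha : a ∈ LinearMap.range L.toLinearMap) (ha' : a' ∈ LinearMap.range L'.toLinearMap)
    (haL : ∀ v, ⟪a, L v⟫_ℝ = ⟪a', L' v⟫_ℝ) (hbL : ∀ v, ⟪b, L v⟫_ℝ = ⟪b', L' v⟫_ℝ) :
    ⟪a, b⟫_ℝ = ⟪a', b'⟫_ℝ := by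
  obtain ⟨v, rfl⟩ := ha
  obtain ⟨v', rfl⟩ := ha'
  obtain rfl : v = v' := ext_inner_right ℝ fun w => by simpa using haL w
  rw [real_inner_comm, real_inner_comm b']
  exact hbL v

variable {L : V →ₗᵢ[ℝ] H} {L' : V →ₗᵢ[ℝ] H'}
  [(LinearMap.range L.toLinearMap).HasOrthogonalProjection]
  [(LinearMap.range L'.toLinearMap).HasOrthogonalProjection] {a b : H} {a' b' : H'}

theorem inner_starProjection_range_eq (haL : ∀ v, ⟪a, L v⟫_ℝ = ⟪a', L' v⟫_ℝ)
    (hbL : ∀ v, ⟪b, L v⟫_ℝ = ⟪b', L' v⟫_ℝ) :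
    ⟪(LinearMap.range L.toLinearMap).starProjection a, b⟫_ℝ =
      ⟪(LinearMap.range L'.toLinearMap).starProjection a', b'⟫_ℝ :=
  inner_eq_inner_of_mem_range (Submodule.starProjection_apply_mem _ a)
    (Submodule.starProjection_apply_mem _ a')
    (fun v => calc
      _ = ⟪a, L v⟫_ℝ := Submodule.inner_orthogonalProjectionOnto_eq_of_mem_right
        (⟨L v, v, rfl⟩ : LinearMap.range L.toLinearMap) a
      _ = ⟪a', L' v⟫_ℝ := haL v
      _ = _ := (Submodule.inner_orthogonalProjectionOnto_eq_of_mem_right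
        (⟨L' v, v, rfl⟩ : LinearMap.range L'.toLinearMap) a').symm)
    hbL

theorem inner_starProjection_range_orthogonal_sub (haL : ∀ v, ⟪a, L v⟫_ℝ = ⟪a', L' v⟫_ℝ)
    (hbL : ∀ v, ⟪b, L v⟫_ℝ = ⟪b', L' v⟫_ℝ) :
    ⟪(LinearMap.range L.toLinearMap)ᗮ.starProjection a, b⟫_ℝ -
        ⟪(LinearMap.range L'.toLinearMap)ᗮ.starProjection a', b'⟫_ℝ = ⟪a, b⟫_ℝ - ⟪a', b'⟫_ℝ := by
  simp only [Submodule.starProjection_orthogonal_val, inner_sub_left,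
    inner_starProjection_range_eq haL hbL]
  ring

end LinearAlgebra

section Trace

variable {ι H : Type*} [Fintype ι] [NormedAddCommGroup H] [InnerProductSpace ℝ H]
  [FiniteDimensional ℝ H] {K : Submodule ℝ H}

theorem trace_compression_eq_sum_inner (b : OrthonormalBasis ι ℝ K) (A : H →ₗ[ℝ] H) :
    LinearMap.trace ℝ K (compression K A) = ∑ i, ⟪(b i : H), A (b i)⟫_ℝ := by
  rw [LinearMap.trace_eq_sum_inner _ b]
  simp [compression]

theorem trace_starProjection_mul_eq_sum_inner (b : OrthonormalBasis ι ℝ K) (A : H →L[ℝ] H) :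
    LinearMap.trace ℝ H ↑(K.starProjection * A) = ∑ i, ⟪(b i : H), A (b i)⟫_ℝ :=
  (LinearMap.trace_comp_comm' K.subtype
    ((K.orthogonalProjectionOnto : H →ₗ[ℝ] K) ∘ₗ (A : H →ₗ[ℝ] H))).symm.trans
      (trace_compression_eq_sum_inner b (A : H →ₗ[ℝ] H))

theorem trace_mul_eq_two_mul_sum_inner (b : OrthonormalBasis ι ℝ K) {A B : H →L[ℝ] H}
    (hA : IsSelfAdjoint A) (hB : IsSelfAdjoint B)
    (hAK : A = K.starProjection * A + A * K.starProjection) :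
    LinearMap.trace ℝ H ↑(A * B) = 2 * ∑ i, ⟪A (b i), B (b i)⟫_ℝ := by
  have trace_mul_cycle : LinearMap.trace ℝ H ↑(A * K.starProjection * B) =
      LinearMap.trace ℝ H ↑(K.starProjection * (B * A)) :=
    (LinearMap.trace_mul_comm ℝ (A : H →ₗ[ℝ] H) (↑(K.starProjection * B) : H →ₗ[ℝ] H))
  calc LinearMap.trace ℝ H ↑(A * B)
      = LinearMap.trace ℝ H ↑(K.starProjection * (A * B)) +
          LinearMap.trace ℝ H ↑(K.starProjection * (B * A)) := by
        nth_rw 1 [hAK]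
        rw [add_mul, ContinuousLinearMap.toLinearMap_add, map_add, trace_mul_cycle, mul_assoc]
    _ = ∑ i, ⟪A (b i), B (b i)⟫_ℝ + ∑ i, ⟪B (b i), A (b i)⟫_ℝ := by
        simp only [trace_starProjection_mul_eq_sum_inner b]
        congr 1 <;> refine Finset.sum_congr rfl fun i _ => ?_
        · exact (hA.isSymmetric _ _).symm
        · exact (hB.isSymmetric _ _).symm
    _ = 2 * ∑ i, ⟪A (b i), B (b i)⟫_ℝ := by
        simp only [real_inner_comm, two_mul]

end Trace

section ProjectionFamilies

variable {V U H : Type*} [NormedAddCommGroup V] [NormedSpace ℝ V]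
  [NormedAddCommGroup U] [InnerProductSpace ℝ U] [FiniteDimensional ℝ U]
  [NormedAddCommGroup H] [InnerProductSpace ℝ H]

theorem fderiv_eq_of_isIdempotentElem {𝔸 : Type*} [NormedRing 𝔸] [NormedAlgebra ℝ 𝔸] {P : V → 𝔸}
    {p : V} (hP : DifferentiableAt ℝ P p) (hidem : ∀ᶠ y in 𝓝 p, IsIdempotentElem (P y)) (u : V) :
    fderiv ℝ P p u = P p * fderiv ℝ P p u + fderiv ℝ P p u * P p := by
  have : P =ᶠ[𝓝 p] P * P := hidem.mono fun y hy => hy.symm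
  nth_rw 1 [this.fderiv_eq, fderiv_mul' hP hP]
  rfl

theorem isSelfAdjoint_fderiv {𝔸 : Type*} [NormedAddCommGroup 𝔸] [NormedSpace ℝ 𝔸]
    [StarAddMonoid 𝔸] [StarModule ℝ 𝔸] [ContinuousStar 𝔸] {P : V → 𝔸} {p : V}
    (hself : ∀ᶠ y in 𝓝 p, IsSelfAdjoint (P y)) (u : V) : IsSelfAdjoint (fderiv ℝ P p u) := by
  have : (fun y => star (P y)) =ᶠ[𝓝 p] P := hself.mono fun y hy => hy.star_eq
  calc star (fderiv ℝ P p u) = fderiv ℝ (fun y => star (P y)) p u := by rw [fderiv_star]; rfl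
    _ = fderiv ℝ P p u := by rw [this.fderiv_eq]

theorem fderiv_starProjection_apply {K : V → Submodule ℝ H} [∀ y, (K y).HasOrthogonalProjection]
    {s : V → H} {p : V} (hK : DifferentiableAt ℝ (fun y => (K y).starProjection) p)
    (hs : DifferentiableAt ℝ s p) (hsK : ∀ᶠ y in 𝓝 p, s y ∈ K y) (u : V) :
    fderiv ℝ (fun y => (K y).starProjection) p u (s p) =
      (K p)ᗮ.starProjection (fderiv ℝ s p u) := by
  have proj_section : (fun y => (K y).starProjection (s y)) =ᶠ[𝓝 p] s :=
    hsK.mono fun y hy => Submodule.starProjection_eq_self_iff.2 hy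
  have leibniz : fderiv ℝ (fun y => (K y).starProjection (s y)) p u = fderiv ℝ s p u := by
    rw [proj_section.fderiv_eq]
  rw [fderiv_clm_apply hK hs] at leibniz
  rw [Submodule.starProjection_orthogonal_val, eq_sub_iff_add_eq, add_comm]
  simpa using leibniz

variable [CompleteSpace H]

theorem isUnit_adjoint_comp_self {L : U →L[ℝ] H} (hL : Function.Injective L) :
    IsUnit (L.adjoint ∘L L) := by
  have : Function.Injective (L.adjoint ∘L L) := L.adjoint_comp_self_injective_iff.2 hL
  exact ContinuousLinearMap.isUnit_iff_bijective.2
    ⟨this, (LinearMap.injective_iff_surjective (f := (↑(L.adjoint ∘L L) : U →ₗ[ℝ] U))).1 this⟩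

theorem starProjection_range_eq_comp {L : U →L[ℝ] H} (hL : Function.Injective L) :
    (LinearMap.range (L : U →ₗ[ℝ] H)).starProjection =
      L ∘L Ring.inverse (L.adjoint ∘L L) ∘L L.adjoint := by
  ext1 a
  refine Submodule.eq_starProjection_of_mem_orthogonal ⟨_, rfl⟩ ?_
  have normal_equation : L.adjoint (L (Ring.inverse (L.adjoint ∘L L) (L.adjoint a))) =
      L.adjoint a :=
    congr($(Ring.mul_inverse_cancel _ (isUnit_adjoint_comp_self hL)) (L.adjoint a))
  rintro _ ⟨w, rfl⟩
  simp [inner_sub_right, ← ContinuousLinearMap.adjoint_inner_right, normal_equation]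

theorem differentiableAt_starProjection_range {L : V → U →L[ℝ] H} {p : V}
    (hL : DifferentiableAt ℝ L p) (hinj : Function.Injective (L p)) :
    DifferentiableAt ℝ (fun y => (LinearMap.range (L y : U →ₗ[ℝ] H)).starProjection) p := by
  have hadj : DifferentiableAt ℝ (fun y => (L y).adjoint) p :=
    (ContinuousLinearMap.adjoint (𝕜 := ℝ) (E := U)
      (F := H)).toContinuousLinearEquiv.differentiableAt.comp p hL
  have hgram : DifferentiableAt ℝ (fun y => (L y).adjoint ∘L L y) p := hadj.clm_comp hL
  have hinv : DifferentiableAt ℝ (fun y => Ring.inverse ((L y).adjoint ∘L L y)) p :=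
    DifferentiableAt.comp (g := Ring.inverse) p
      (differentiableAt_inverse (isUnit_adjoint_comp_self hinj)) hgram
  refine (hL.clm_comp (hinv.clm_comp hadj)).congr_of_eventuallyEq ?_
  filter_upwards [hL.continuousAt.eventually
    (ContinuousLinearMap.isOpen_injective.mem_nhds hinj)] with y hy
  exact starProjection_range_eq_comp hy

end ProjectionFamilies

section Charts

theorem mvfderiv_comp_mfderiv {𝕜 E₁ H₁ M E₂ H₂ N V : Type*} [NontriviallyNormedField 𝕜]
    [NormedAddCommGroup E₁] [NormedSpace 𝕜 E₁] [TopologicalSpace H₁] {I : ModelWithCorners 𝕜 E₁ H₁}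
    [TopologicalSpace M] [ChartedSpace H₁ M]
    [NormedAddCommGroup E₂] [NormedSpace 𝕜 E₂] [TopologicalSpace H₂] {J : ModelWithCorners 𝕜 E₂ H₂}
    [TopologicalSpace N] [ChartedSpace H₂ N] [NormedAddCommGroup V] [NormedSpace 𝕜 V]
    {g : N → V} {f : M → N} {x : M} (hg : MDifferentiableAt J 𝓘(𝕜, V) g (f x))
    (hf : MDifferentiableAt I J f x) :
    mvfderiv I (g ∘ f) x = mvfderiv J g (f x) ∘L mfderiv I J f x := by
  simp only [mvfderiv, mfderiv_comp x hg hf]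
  rfl

variable {m k : ℕ} {M S V : Type*} [TopologicalSpace M] [ChartedSpace (E m) M]
  [NormedAddCommGroup V] [NormedSpace ℝ V] {x y : M}

theorem comp_extChartAt_symm_comp_eventuallyEq (hy : y ∈ (extChartAt (𝓡 m) x).source)
    (f : M → S) : (f ∘ (extChartAt (𝓡 m) x).symm) ∘ extChartAt (𝓡 m) x =ᶠ[𝓝 y] f := by
  filter_upwards [(isOpen_extChartAt_source x).mem_nhds hy] with z hz
  exact congrArg f ((extChartAt (𝓡 m) x).left_inv hz)

/-- The second derivative at `x` of `f` in the preferred chart around `x`. It is not a tensor, but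
its component normal to `f` is the second fundamental form. -/
noncomputable def chartHessian (f : M → V) (x : M) :
    TangentSpace (𝓡 m) x →ₗ[ℝ] TangentSpace (𝓡 m) x →ₗ[ℝ] V :=
  let φ := extChartAt (𝓡 m) x
  let dφ : TangentSpace (𝓡 m) x →ₗ[ℝ] E m := mvfderiv (𝓡 m) φ x
  (fderiv ℝ (fderiv ℝ (f ∘ φ.symm)) (φ x)).toLinearMap₁₂.compl₁₂ dφ dφ

theorem chartHessian_apply (f : M → V) (X Y : TangentSpace (𝓡 m) x) :
    chartHessian f x X Y = fderiv ℝ (fderiv ℝ (f ∘ (extChartAt (𝓡 m) x).symm))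
      (extChartAt (𝓡 m) x x) (mvfderiv (𝓡 m) (extChartAt (𝓡 m) x) x X)
      (mvfderiv (𝓡 m) (extChartAt (𝓡 m) x) x Y) :=
  rfl

theorem secondFF_apply (f : M → E k) (X Y : TangentSpace (𝓡 m) x) :
    secondFF m k f x X Y = (tangentImage m k f x)ᗮ.starProjection (chartHessian f x X Y) :=
  rfl

theorem inner_secondFF_secondFF (f : M → E k) (X Y Z W : TangentSpace (𝓡 m) x) :
    ⟪secondFF m k f x X Y, secondFF m k f x Z W⟫_ℝ =
      ⟪(tangentImage m k f x)ᗮ.starProjection (chartHessian f x X Y), chartHessian f x Z W⟫_ℝ := by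
  rw [secondFF_apply, secondFF_apply, ← Submodule.inner_starProjection_left_eq_right,
    Submodule.starProjection_eq_self_iff.2 (Submodule.starProjection_apply_mem _ _)]

variable [IsManifold (𝓡 m) ∞ M]

theorem mvfderiv_eq_fderiv_comp_of_eventuallyEq (hy : y ∈ (extChartAt (𝓡 m) x).source)
    {f : M → V} {g : E m → V} (hg : DifferentiableAt ℝ g (extChartAt (𝓡 m) x y))
    (h : g ∘ extChartAt (𝓡 m) x =ᶠ[𝓝 y] f) :
    mvfderiv (𝓡 m) f y =
      fderiv ℝ g (extChartAt (𝓡 m) x y) ∘L mvfderiv (𝓡 m) (extChartAt (𝓡 m) x) y := by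
  have hφ : MDifferentiableAt (𝓡 m) 𝓘(ℝ, E m) (extChartAt (𝓡 m) x) y :=
    mdifferentiableAt_extChartAt (by simpa using hy)
  rw [mvfderiv, ← h.mfderiv_eq]
  refine (mvfderiv_comp_mfderiv hg.mdifferentiableAt hφ).trans ?_
  rw [mvfderiv, mfderiv_eq_fderiv]
  rfl

theorem bijective_mvfderiv_extChartAt (hy : y ∈ (extChartAt (𝓡 m) x).source) :
    Function.Bijective (mvfderiv (𝓡 m) (extChartAt (𝓡 m) x) y) := by
  obtain ⟨e, he⟩ := isInvertible_mfderiv_extChartAt hy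
  have : ⇑(mvfderiv (𝓡 m) (extChartAt (𝓡 m) x) y) = e := by
    rw [← ContinuousLinearEquiv.coe_coe, he]; rfl
  exact this ▸ e.bijective

theorem contDiffAt_comp_extChartAt_symm {r : WithTop ℕ∞} (hr : r ≤ ∞) {f : M → V}
    (hy : y ∈ (extChartAt (𝓡 m) x).source) (hf : ContMDiffAt (𝓡 m) 𝓘(ℝ, V) r f y) :
    ContDiffAt ℝ r (f ∘ (extChartAt (𝓡 m) x).symm) (extChartAt (𝓡 m) x y) := by
  have hφ : ContMDiffAt 𝓘(ℝ, E m) (𝓡 m) ∞ (extChartAt (𝓡 m) x).symm (extChartAt (𝓡 m) x y) :=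
    (contMDiffOn_extChartAt_symm x).contMDiffAt
      ((isOpen_extChartAt_target x).mem_nhds ((extChartAt (𝓡 m) x).map_source hy))
  refine (ContMDiffAt.comp _ ?_ (hφ.of_le hr)).contDiffAt
  rwa [(extChartAt (𝓡 m) x).left_inv hy]

theorem mvfderiv_eq_fderiv_comp_extChartAt (hy : y ∈ (extChartAt (𝓡 m) x).source) {f : M → V}
    (hf : ContMDiffAt (𝓡 m) 𝓘(ℝ, V) 1 f y) :
    mvfderiv (𝓡 m) f y = fderiv ℝ (f ∘ (extChartAt (𝓡 m) x).symm) (extChartAt (𝓡 m) x y) ∘L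
      mvfderiv (𝓡 m) (extChartAt (𝓡 m) x) y :=
  mvfderiv_eq_fderiv_comp_of_eventuallyEq hy
    ((contDiffAt_comp_extChartAt_symm (by simp) hy hf).differentiableAt one_ne_zero)
    (comp_extChartAt_symm_comp_eventuallyEq hy f)

theorem tangentImage_eq_range_fderiv (hy : y ∈ (extChartAt (𝓡 m) x).source) {f : M → E k}
    (hf : ContMDiffAt (𝓡 m) (𝓡 k) 1 f y) :
    tangentImage m k f y = LinearMap.range
      (fderiv ℝ (f ∘ (extChartAt (𝓡 m) x).symm) (extChartAt (𝓡 m) x y) : E m →ₗ[ℝ] E k) := by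
  rw [tangentImage, mvfderiv_eq_fderiv_comp_extChartAt hy hf]
  exact LinearMap.range_comp_of_range_eq_top _
    (LinearMap.range_eq_top.2 (bijective_mvfderiv_extChartAt hy).surjective)

theorem chartHessian_comm {f : M → V} (hf : ContMDiffAt (𝓡 m) 𝓘(ℝ, V) 2 f x)
    (X Y : TangentSpace (𝓡 m) x) : chartHessian f x X Y = chartHessian f x Y X :=
  fderiv_fderiv_comm
    (contDiffAt_comp_extChartAt_symm (by norm_cast) (mem_extChartAt_source x) hf) _ _

end Charts

section IsometricImmersions

variable {m k l : ℕ} {M : Type*} [TopologicalSpace M] [ChartedSpace (E m) M]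
  [IsManifold (𝓡 m) ∞ M] [RiemannianBundle (fun x : M => TangentSpace (𝓡 m) x)]
  {f : M → E k} {g : M → E l} {x y : M}

/-- The differential at `x` of an isometric immersion into Euclidean space, as a linear isometry. -/
noncomputable def IsIsometricImmersion.differential (hf : IsIsometricImmersion m k f) (x : M) :
    TangentSpace (𝓡 m) x →ₗᵢ[ℝ] E k :=
  LinearMap.isometryOfInner (mvfderiv (𝓡 m) f x : TangentSpace (𝓡 m) x →ₗ[ℝ] E k) (hf.inner_map x)

theorem IsIsometricImmersion.range_differential (hf : IsIsometricImmersion m k f) :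
    LinearMap.range (hf.differential x).toLinearMap = tangentImage m k f x :=
  rfl

theorem IsIsometricImmersion.contDiffAt (hf : IsIsometricImmersion m k f)
    (hy : y ∈ (extChartAt (𝓡 m) x).source) :
    ContDiffAt ℝ ∞ (f ∘ (extChartAt (𝓡 m) x).symm) (extChartAt (𝓡 m) x y) :=
  contDiffAt_comp_extChartAt_symm le_rfl hy (hf.contMDiff y)

theorem IsIsometricImmersion.differential_eq_fderiv (hf : IsIsometricImmersion m k f)
    (hy : y ∈ (extChartAt (𝓡 m) x).source) (X : TangentSpace (𝓡 m) y) :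
    hf.differential y X = fderiv ℝ (f ∘ (extChartAt (𝓡 m) x).symm) (extChartAt (𝓡 m) x y)
      (mvfderiv (𝓡 m) (extChartAt (𝓡 m) x) y X) :=
  congr($(mvfderiv_eq_fderiv_comp_extChartAt hy ((hf.contMDiff y).of_le (by simp))) X)

theorem IsIsometricImmersion.inducedMetric_apply (hf : IsIsometricImmersion m k f)
    (hy : y ∈ (extChartAt (𝓡 m) x).source) (X Y : TangentSpace (𝓡 m) y) :
    inducedMetric (f ∘ (extChartAt (𝓡 m) x).symm) (extChartAt (𝓡 m) x y)
      (mvfderiv (𝓡 m) (extChartAt (𝓡 m) x) y X) (mvfderiv (𝓡 m) (extChartAt (𝓡 m) x) y Y) =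
        ⟪X, Y⟫_ℝ := by
  rw [inducedMetric, ← hf.differential_eq_fderiv hy, ← hf.differential_eq_fderiv hy,
    LinearIsometry.inner_map_map]

theorem IsIsometricImmersion.inducedMetric_eventuallyEq (hf : IsIsometricImmersion m k f)
    (hg : IsIsometricImmersion m l g) (x : M) :
    inducedMetric (f ∘ (extChartAt (𝓡 m) x).symm) =ᶠ[𝓝 (extChartAt (𝓡 m) x x)]
      inducedMetric (g ∘ (extChartAt (𝓡 m) x).symm) := by
  filter_upwards [extChartAt_target_mem_nhds (I := 𝓡 m) x] with p hp
  have hy := (extChartAt (𝓡 m) x).map_target hp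
  rw [← (extChartAt (𝓡 m) x).right_inv hp]
  funext u v
  obtain ⟨X, rfl⟩ := (bijective_mvfderiv_extChartAt hy).surjective u
  obtain ⟨Y, rfl⟩ := (bijective_mvfderiv_extChartAt hy).surjective v
  rw [hf.inducedMetric_apply hy, hg.inducedMetric_apply hy]

theorem IsIsometricImmersion.injective_fderiv (hf : IsIsometricImmersion m k f) (x : M) :
    Function.Injective (fderiv ℝ (f ∘ (extChartAt (𝓡 m) x).symm) (extChartAt (𝓡 m) x x)) := by
  have hx := mem_extChartAt_source (I := 𝓡 m) x
  refine .of_comp_right (fun X Y hXY => (hf.differential x).injective ?_)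
    (bijective_mvfderiv_extChartAt hx).surjective
  rwa [hf.differential_eq_fderiv hx, hf.differential_eq_fderiv hx]

theorem IsIsometricImmersion.christoffel_eq (hf : IsIsometricImmersion m k f)
    (hg : IsIsometricImmersion m l g) (x : M) :
    christoffel (f ∘ (extChartAt (𝓡 m) x).symm) (extChartAt (𝓡 m) x x) =
      christoffel (g ∘ (extChartAt (𝓡 m) x).symm) (extChartAt (𝓡 m) x x) :=
  christoffel_eq_of_inducedMetric_eq
    ((hf.contDiffAt (mem_extChartAt_source x)).of_le (by norm_cast))
    ((hg.contDiffAt (mem_extChartAt_source x)).of_le (by norm_cast))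
    (hf.inducedMetric_eventuallyEq hg x)

theorem IsIsometricImmersion.inner_chartHessian_differential_eq
    (hf : IsIsometricImmersion m k f) (hg : IsIsometricImmersion m l g)
    (X Y Z : TangentSpace (𝓡 m) x) :
    ⟪chartHessian f x X Y, hf.differential x Z⟫_ℝ =
      ⟪chartHessian g x X Y, hg.differential x Z⟫_ℝ := by
  have hx := mem_extChartAt_source (I := 𝓡 m) x
  rw [hf.differential_eq_fderiv hx, hg.differential_eq_fderiv hx]
  exact congrFun (congrFun₂ (hf.christoffel_eq hg x) _ _) _

theorem IsIsometricImmersion.secondFF_comm (hf : IsIsometricImmersion m k f)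
    (X Y : TangentSpace (𝓡 m) x) : secondFF m k f x X Y = secondFF m k f x Y X := by
  rw [secondFF_apply, secondFF_apply,
    chartHessian_comm ((hf.contMDiff x).of_le (by norm_cast))]

/-- Gauss equation: both sides are the curvature of `M`. -/
theorem IsIsometricImmersion.inner_secondFF_sub_eq (hf : IsIsometricImmersion m k f)
    (hg : IsIsometricImmersion m l g) (X Y Z W : TangentSpace (𝓡 m) x) :
    ⟪secondFF m k f x X Y, secondFF m k f x Z W⟫_ℝ -
        ⟪secondFF m k f x Z Y, secondFF m k f x X W⟫_ℝ =
      ⟪secondFF m l g x X Y, secondFF m l g x Z W⟫_ℝ -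
        ⟪secondFF m l g x Z Y, secondFF m l g x X W⟫_ℝ := by
  have hx := mem_extChartAt_source (I := 𝓡 m) x
  have normal_sub (X Y Z W : TangentSpace (𝓡 m) x) :
      ⟪secondFF m k f x X Y, secondFF m k f x Z W⟫_ℝ -
          ⟪secondFF m l g x X Y, secondFF m l g x Z W⟫_ℝ =
        ⟪chartHessian f x X Y, chartHessian f x Z W⟫_ℝ -
          ⟪chartHessian g x X Y, chartHessian g x Z W⟫_ℝ := by
    rw [inner_secondFF_secondFF, inner_secondFF_secondFF]
    simpa only [range_differential] using inner_starProjection_range_orthogonal_sub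
      (hf.inner_chartHessian_differential_eq hg X Y) (hf.inner_chartHessian_differential_eq hg Z W)
  have egregium := inner_fderiv_fderiv_sub_eq_of_inducedMetric_eq
    ((hf.contDiffAt hx).of_le (by norm_cast)) ((hg.contDiffAt hx).of_le (by norm_cast))
    (hf.inducedMetric_eventuallyEq hg x) (mvfderiv (𝓡 m) (extChartAt (𝓡 m) x) x X)
    (mvfderiv (𝓡 m) (extChartAt (𝓡 m) x) x Y) (mvfderiv (𝓡 m) (extChartAt (𝓡 m) x) x W)
    (mvfderiv (𝓡 m) (extChartAt (𝓡 m) x) x Z)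
  simp only [← chartHessian_apply] at egregium
  linarith [normal_sub X Y Z W, normal_sub Z Y X W]

/-- The trace of the second fundamental form, that is `m` times the mean curvature vector. -/
noncomputable def traceSecondFF (m k : ℕ) {M : Type*} [TopologicalSpace M] [ChartedSpace (E m) M]
    [RiemannianBundle (fun x : M => TangentSpace (𝓡 m) x)] (f : M → E k) (x : M) : E k :=
  let b := stdOrthonormalBasis ℝ (TangentSpace (𝓡 m) x)
  ∑ i, secondFF m k f x (b i) (b i)

/-- Contracted Gauss equation: both sides are the Ricci tensor of `M`. -/
theorem IsIsometricImmersion.inner_traceSecondFF_sub_thirdFF_eq (hf : IsIsometricImmersion m k f)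
    (hg : IsIsometricImmersion m l g) (X Y : TangentSpace (𝓡 m) x) :
    ⟪traceSecondFF m k f x, secondFF m k f x X Y⟫_ℝ - thirdFF m k f x X Y =
      ⟪traceSecondFF m l g x, secondFF m l g x X Y⟫_ℝ - thirdFF m l g x X Y := by
  simp only [traceSecondFF, thirdFF, sum_inner, ← Finset.sum_sub_distrib]
  refine Finset.sum_congr rfl fun i _ => ?_
  rw [hf.secondFF_comm Y, hg.secondFF_comm Y]
  simpa only [real_inner_comm] using hf.inner_secondFF_sub_eq hg
    (stdOrthonormalBasis ℝ (TangentSpace (𝓡 m) x) i)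
    (stdOrthonormalBasis ℝ (TangentSpace (𝓡 m) x) i) X Y

end IsometricImmersions

section GaussMap

variable {m k : ℕ} {M : Type*} [TopologicalSpace M] [ChartedSpace (E m) M]
  [IsManifold (𝓡 m) ∞ M] [RiemannianBundle (fun x : M => TangentSpace (𝓡 m) x)]
  {f : M → E k} {x y : M}

/-- The Gauss map of `f` in the preferred chart around `x`. -/
noncomputable def chartGaussMap (f : M → E k) (x : M) (p : E m) : E k →L[ℝ] E k :=
  (LinearMap.range (fderiv ℝ (f ∘ (extChartAt (𝓡 m) x).symm) p : E m →ₗ[ℝ] E k)).starProjection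

theorem IsIsometricImmersion.differentiableAt_fderiv (hf : IsIsometricImmersion m k f) (x : M) :
    DifferentiableAt ℝ (fderiv ℝ (f ∘ (extChartAt (𝓡 m) x).symm)) (extChartAt (𝓡 m) x x) :=
  ((hf.contDiffAt (mem_extChartAt_source x)).fderiv_right (m := 1)
    (by norm_cast)).differentiableAt one_ne_zero

theorem IsIsometricImmersion.differentiableAt_chartGaussMap (hf : IsIsometricImmersion m k f)
    (x : M) : DifferentiableAt ℝ (chartGaussMap f x) (extChartAt (𝓡 m) x x) :=
  differentiableAt_starProjection_range (hf.differentiableAt_fderiv x) (hf.injective_fderiv x)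

theorem IsIsometricImmersion.gaussMap_eq_chartGaussMap (hf : IsIsometricImmersion m k f)
    (hy : y ∈ (extChartAt (𝓡 m) x).source) :
    gaussMap m k f y = chartGaussMap f x (extChartAt (𝓡 m) x y) := by
  simp only [gaussMap, chartGaussMap,
    tangentImage_eq_range_fderiv hy ((hf.contMDiff y).of_le (by simp))]

theorem IsIsometricImmersion.mvfderiv_gaussMap (hf : IsIsometricImmersion m k f)
    (X : TangentSpace (𝓡 m) x) :
    mvfderiv (𝓡 m) (gaussMap m k f) x X =
      fderiv ℝ (chartGaussMap f x) (extChartAt (𝓡 m) x x)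
        (mvfderiv (𝓡 m) (extChartAt (𝓡 m) x) x X) := by
  refine congr($(mvfderiv_eq_fderiv_comp_of_eventuallyEq (mem_extChartAt_source x)
    (hf.differentiableAt_chartGaussMap x) ?_) X)
  filter_upwards [extChartAt_source_mem_nhds (I := 𝓡 m) x] with y hy
  exact (hf.gaussMap_eq_chartGaussMap hy).symm

theorem IsIsometricImmersion.isSelfAdjoint_mvfderiv_gaussMap (hf : IsIsometricImmersion m k f)
    (X : TangentSpace (𝓡 m) x) : IsSelfAdjoint (mvfderiv (𝓡 m) (gaussMap m k f) x X) := by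
  rw [hf.mvfderiv_gaussMap]
  exact isSelfAdjoint_fderiv (𝔸 := E k →L[ℝ] E k)
    (.of_forall fun _ => isSelfAdjoint_starProjection _) _

theorem IsIsometricImmersion.mvfderiv_gaussMap_eq_add (hf : IsIsometricImmersion m k f)
    (X : TangentSpace (𝓡 m) x) :
    mvfderiv (𝓡 m) (gaussMap m k f) x X =
      gaussMap m k f x * mvfderiv (𝓡 m) (gaussMap m k f) x X +
        mvfderiv (𝓡 m) (gaussMap m k f) x X * gaussMap m k f x := by
  rw [hf.mvfderiv_gaussMap, hf.gaussMap_eq_chartGaussMap (mem_extChartAt_source x)]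
  exact fderiv_eq_of_isIdempotentElem (hf.differentiableAt_chartGaussMap x)
    (.of_forall fun _ => Submodule.isIdempotentElem_starProjection _) _

theorem IsIsometricImmersion.mvfderiv_gaussMap_apply_differential
    (hf : IsIsometricImmersion m k f) (X Y : TangentSpace (𝓡 m) x) :
    (mvfderiv (𝓡 m) (gaussMap m k f) x X : E k →L[ℝ] E k) (hf.differential x Y) =
      secondFF m k f x X Y := by
  have hx := mem_extChartAt_source (I := 𝓡 m) x
  have hf' := hf.differentiableAt_fderiv x
  rw [hf.mvfderiv_gaussMap, hf.differential_eq_fderiv hx]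
  unfold chartGaussMap
  rw [fderiv_starProjection_apply (hf.differentiableAt_chartGaussMap x)
      (hf'.clm_apply (differentiableAt_const _)) (.of_forall fun _ => ⟨_, rfl⟩),
    fderiv_clm_apply_const hf', secondFF_apply,
    tangentImage_eq_range_fderiv hx ((hf.contMDiff x).of_le (by simp))]
  rfl

theorem IsIsometricImmersion.gaussGraphMetric_eq (hf : IsIsometricImmersion m k f)
    (X Y : TangentSpace (𝓡 m) x) :
    gaussGraphMetric m k f x X Y = ⟪X, Y⟫_ℝ + thirdFF m k f x X Y := by
  let b : OrthonormalBasis _ ℝ (tangentImage m k f x) :=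
    (stdOrthonormalBasis ℝ (TangentSpace (𝓡 m) x)).map (hf.differential x).equivRange
  have trace_eq := trace_mul_eq_two_mul_sum_inner b (hf.isSelfAdjoint_mvfderiv_gaussMap X)
    (hf.isSelfAdjoint_mvfderiv_gaussMap Y) (hf.mvfderiv_gaussMap_eq_add X)
  have hb (i) : (b i : E k) = hf.differential x (stdOrthonormalBasis ℝ _ i) := rfl
  simp only [hb, hf.mvfderiv_gaussMap_apply_differential] at trace_eq
  rw [gaussGraphMetric, thirdFF]
  refine congrArg (⟪X, Y⟫_ℝ + ·) ?_
  rw [one_div, inv_mul_eq_iff_eq_mul₀ two_ne_zero]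
  exact trace_eq

end GaussMap

section Composition

variable {n m k l : ℕ} {M N V : Type*} [TopologicalSpace M] [ChartedSpace (E n) M]
  [TopologicalSpace N] [ChartedSpace (E m) N] [NormedAddCommGroup V] [NormedSpace ℝ V]
  {j : M → N} {x : M}

theorem tangentImage_comp_le {F : N → E k} (hF : MDifferentiableAt (𝓡 m) (𝓡 k) F (j x))
    (hj : MDifferentiableAt (𝓡 n) (𝓡 m) j x) :
    tangentImage n k (F ∘ j) x ≤ tangentImage m k F (j x) := by
  rw [tangentImage, mvfderiv_comp_mfderiv hF hj]
  exact LinearMap.range_comp_le_range _ _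

variable [IsManifold (𝓡 n) ∞ M] [IsManifold (𝓡 m) ∞ N]

theorem chartHessian_comp {F : N → V} (hF : ContMDiffAt (𝓡 m) 𝓘(ℝ, V) 2 F (j x))
    (hj : ContMDiffAt (𝓡 n) (𝓡 m) 2 j x) (X Y : TangentSpace (𝓡 n) x) :
    chartHessian (F ∘ j) x X Y =
      chartHessian F (j x) (mfderiv (𝓡 n) (𝓡 m) j x X) (mfderiv (𝓡 n) (𝓡 m) j x Y) +
        fderiv ℝ (F ∘ (extChartAt (𝓡 m) (j x)).symm) (extChartAt (𝓡 m) (j x) (j x))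
          (chartHessian (extChartAt (𝓡 m) (j x) ∘ j) x X Y) := by
  set ψ := extChartAt (𝓡 n) x
  set φ := extChartAt (𝓡 m) (j x)
  have hx : x ∈ ψ.source := mem_extChartAt_source x
  have hjx : j x ∈ φ.source := mem_extChartAt_source (j x)
  have two_le : (2 : WithTop ℕ∞) ≤ ∞ := by norm_cast
  have hφ : ContMDiffAt (𝓡 m) 𝓘(ℝ, E m) 2 φ (j x) := contMDiffAt_extChartAt.of_le two_le
  have hφj : ContMDiffAt (𝓡 n) 𝓘(ℝ, E m) 2 (φ ∘ j) x := hφ.comp x hj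
  have base : ((φ ∘ j) ∘ ψ.symm) (ψ x) = φ (j x) := congrArg (φ ∘ j) (ψ.left_inv hx)
  have factor : (F ∘ j) ∘ ψ.symm =ᶠ[𝓝 (ψ x)] (F ∘ φ.symm) ∘ ((φ ∘ j) ∘ ψ.symm) := by
    have hsymm : Tendsto ψ.symm (𝓝 (ψ x)) (𝓝 x) := by
      simpa only [ContinuousAt, extChartAt_to_inv] using continuousAt_extChartAt_symm (I := 𝓡 n) x
    filter_upwards [hsymm.eventually (hj.continuousAt.eventually
      (extChartAt_source_mem_nhds (I := 𝓡 m) (j x)))] with p hp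
    exact congrArg F (φ.left_inv hp).symm
  have differential (Z : TangentSpace (𝓡 n) x) :
      fderiv ℝ ((φ ∘ j) ∘ ψ.symm) (ψ x) (mvfderiv (𝓡 n) ψ x Z) =
        mvfderiv (𝓡 m) φ (j x) (mfderiv (𝓡 n) (𝓡 m) j x Z) := by
    have := (mvfderiv_eq_fderiv_comp_extChartAt hx (hφj.of_le one_le_two)).symm.trans
      (mvfderiv_comp_mfderiv (hφ.mdifferentiableAt two_ne_zero) (hj.mdifferentiableAt two_ne_zero))
    exact congr($this Z)
  rw [chartHessian_apply, factor.fderiv.fderiv_eq, fderiv_fderiv_comp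
    (base ▸ contDiffAt_comp_extChartAt_symm two_le hjx hF)
    (contDiffAt_comp_extChartAt_symm two_le hx hφj), differential, differential, base]
  rfl

variable [RiemannianBundle (fun y : N => TangentSpace (𝓡 m) y)] {F : N → E k} {G : N → E l}

/-- The point is that `Z` does not depend on the immersion `F` of `N`. -/
theorem exists_chartHessian_comp_eq (hj : ContMDiffAt (𝓡 n) (𝓡 m) 2 j x)
    (X Y : TangentSpace (𝓡 n) x) :
    ∃ Z : TangentSpace (𝓡 m) (j x), ∀ {k : ℕ} {F : N → E k} (hF : IsIsometricImmersion m k F),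
      chartHessian (F ∘ j) x X Y =
        chartHessian F (j x) (mfderiv (𝓡 n) (𝓡 m) j x X) (mfderiv (𝓡 n) (𝓡 m) j x Y) +
          hF.differential (j x) Z := by
  have hjx := mem_extChartAt_source (I := 𝓡 m) (j x)
  obtain ⟨Z, hZ⟩ := (bijective_mvfderiv_extChartAt hjx).surjective
    (chartHessian (extChartAt (𝓡 m) (j x) ∘ j) x X Y)
  refine ⟨Z, fun hF => ?_⟩
  rw [hF.differential_eq_fderiv hjx, hZ]
  exact chartHessian_comp ((hF.contMDiff _).of_le (by norm_cast)) hj X Y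

theorem IsIsometricImmersion.starProjection_orthogonal_secondFF_comp
    (hF : IsIsometricImmersion m k F) (hj : ContMDiffAt (𝓡 n) (𝓡 m) 2 j x)
    (X Y : TangentSpace (𝓡 n) x) :
    (tangentImage m k F (j x))ᗮ.starProjection (secondFF n k (F ∘ j) x X Y) =
      secondFF m k F (j x) (mfderiv (𝓡 n) (𝓡 m) j x X) (mfderiv (𝓡 n) (𝓡 m) j x Y) := by
  obtain ⟨Z, hZ⟩ := exists_chartHessian_comp_eq hj X Y
  have hle := Submodule.orthogonal_le (tangentImage_comp_le
    (hF.contMDiff.mdifferentiableAt (by simp)) (hj.mdifferentiableAt two_ne_zero))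
  have tangent : (tangentImage m k F (j x))ᗮ.starProjection (hF.differential (j x) Z) = 0 :=
    Submodule.starProjection_orthogonal_apply_eq_zero ⟨Z, rfl⟩
  rw [secondFF_apply, secondFF_apply, ← ContinuousLinearMap.comp_apply,
    Submodule.starProjection_comp_starProjection_of_le hle, hZ hF, map_add, tangent, add_zero]

theorem IsIsometricImmersion.inner_chartHessian_comp_differential_eq
    (hF : IsIsometricImmersion m k F) (hG : IsIsometricImmersion m l G)
    (hj : ContMDiffAt (𝓡 n) (𝓡 m) 2 j x) (X Y : TangentSpace (𝓡 n) x)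
    (w : TangentSpace (𝓡 m) (j x)) :
    ⟪chartHessian (F ∘ j) x X Y, hF.differential (j x) w⟫_ℝ =
      ⟪chartHessian (G ∘ j) x X Y, hG.differential (j x) w⟫_ℝ := by
  obtain ⟨Z, hZ⟩ := exists_chartHessian_comp_eq hj X Y
  rw [hZ hF, hZ hG, inner_add_left, inner_add_left, LinearIsometry.inner_map_map,
    LinearIsometry.inner_map_map, hF.inner_chartHessian_differential_eq hG]

variable [RiemannianBundle (fun x : M => TangentSpace (𝓡 n) x)]

theorem IsIsometricImmersion.comp {P : Type*} [TopologicalSpace P] [ChartedSpace (E k) P]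
    [IsManifold (𝓡 k) ∞ P] [RiemannianBundle (fun z : P => TangentSpace (𝓡 k) z)] {F : N → P}
    (hF : IsIsometricImmersion m k F) (hj : IsIsometricImmersion n m j) :
    IsIsometricImmersion n k (F ∘ j) where
  contMDiff := hF.contMDiff.comp hj.contMDiff
  inner_map x X Y := by
    rw [mfderiv_comp x (hF.contMDiff.mdifferentiableAt (by simp))
      (hj.contMDiff.mdifferentiableAt (by simp))]
    exact (hF.inner_map _ _ _).trans (hj.inner_map x X Y)

theorem IsIsometricImmersion.differential_comp (hF : IsIsometricImmersion m k F)
    (hj : IsIsometricImmersion n m j) (X : TangentSpace (𝓡 n) x) :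
    (hF.comp hj).differential x X =
      hF.differential (j x) (mfderiv (𝓡 n) (𝓡 m) j x X) :=
  congr($(mvfderiv_comp_mfderiv (hF.contMDiff.mdifferentiableAt (by simp))
    (hj.contMDiff.mdifferentiableAt (by simp))) X)

theorem IsIsometricImmersion.inner_secondFF_comp_differential_eq
    (hF : IsIsometricImmersion m k F) (hG : IsIsometricImmersion m l G)
    (hj : IsIsometricImmersion n m j) (X Y : TangentSpace (𝓡 n) x)
    (w : TangentSpace (𝓡 m) (j x)) :
    ⟪secondFF n k (F ∘ j) x X Y, hF.differential (j x) w⟫_ℝ =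
      ⟪secondFF n l (G ∘ j) x X Y, hG.differential (j x) w⟫_ℝ := by
  have tangential := inner_starProjection_range_eq
    ((hF.comp hj).inner_chartHessian_differential_eq (hG.comp hj) X Y)
    (b := hF.differential (j x) w) (b' := hG.differential (j x) w) fun Z => by
      rw [hF.differential_comp hj, hG.differential_comp hj, LinearIsometry.inner_map_map,
        LinearIsometry.inner_map_map]
  simp only [range_differential] at tangential
  simp only [secondFF_apply, Submodule.starProjection_orthogonal_val, inner_sub_left, tangential,
    hF.inner_chartHessian_comp_differential_eq hG ((hj.contMDiff x).of_le (by norm_cast))]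

end Composition

section TracelessCompressions

variable {n m k l : ℕ} {M N : Type*} [TopologicalSpace N] [ChartedSpace (E m) N]
  [RiemannianBundle (fun y : N => TangentSpace (𝓡 m) y)] {F : N → E k} {G : N → E l}

theorem trace_compression_shapeOperator {ι : Type*} [Fintype ι] {y : N}
    {W : Submodule ℝ (TangentSpace (𝓡 m) y)} (b : OrthonormalBasis ι ℝ W) (ξ : E k) :
    LinearMap.trace ℝ W (compression W (shapeOperator m k F y ξ)) =
      ⟪∑ i, secondFF m k F y (b i) (b i), ξ⟫_ℝ := by
  simp only [trace_compression_eq_sum_inner b, shapeOperator, LinearMap.coe_mk, AddHom.coe_mk,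
    LinearMap.adjoint_inner_right, sum_inner]

theorem sum_secondFF_eq_zero_of_trace_compression_eq_zero {ι : Type*} [Fintype ι] {y : N}
    {W : Submodule ℝ (TangentSpace (𝓡 m) y)} (b : OrthonormalBasis ι ℝ W)
    (htr : ∀ ξ ∈ (tangentImage m k F y)ᗮ, ‖ξ‖ = 1 →
      LinearMap.trace ℝ W (compression W (shapeOperator m k F y ξ)) = 0) :
    ∑ i, secondFF m k F y (b i) (b i) = 0 := by
  set η := ∑ i, secondFF m k F y (b i) (b i) with hη
  have normal : η ∈ (tangentImage m k F y)ᗮ :=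
    Submodule.sum_mem _ fun i _ => Submodule.starProjection_apply_mem _ _
  by_contra hne
  have inner_eq_zero := htr (‖η‖⁻¹ • η) (Submodule.smul_mem _ _ normal) (norm_smul_inv_norm hne)
  rw [trace_compression_shapeOperator b, ← hη, inner_smul_right, mul_eq_zero] at inner_eq_zero
  simp [hne] at inner_eq_zero

variable [TopologicalSpace M] [ChartedSpace (E n) M] [IsManifold (𝓡 n) ∞ M]
  [IsManifold (𝓡 m) ∞ N] [RiemannianBundle (fun x : M => TangentSpace (𝓡 n) x)]
  {j : M → N} {x : M}

theorem IsIsometricImmersion.traceSecondFF_comp_mem_tangentImage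
    (hF : IsIsometricImmersion m k F) (hj : IsIsometricImmersion n m j)
    (htr : ∀ ξ ∈ (tangentImage m k F (j x))ᗮ, ‖ξ‖ = 1 →
      LinearMap.trace ℝ _ (compression (LinearMap.range (mfderiv (𝓡 n) (𝓡 m) j x).toLinearMap)
        (shapeOperator m k F (j x) ξ)) = 0) :
    traceSecondFF n k (F ∘ j) x ∈ tangentImage m k F (j x) := by
  let dj : TangentSpace (𝓡 n) x →ₗᵢ[ℝ] TangentSpace (𝓡 m) (j x) :=
    LinearMap.isometryOfInner (mfderiv (𝓡 n) (𝓡 m) j x).toLinearMap (hj.inner_map x)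
  let b : OrthonormalBasis _ ℝ (LinearMap.range (mfderiv (𝓡 n) (𝓡 m) j x).toLinearMap) :=
    (stdOrthonormalBasis ℝ (TangentSpace (𝓡 n) x)).map dj.equivRange
  rw [← Submodule.orthogonal_orthogonal (tangentImage m k F (j x)),
    ← Submodule.starProjection_apply_eq_zero_iff, traceSecondFF, map_sum]
  simp only [hF.starProjection_orthogonal_secondFF_comp ((hj.contMDiff x).of_le (by norm_cast))]
  exact sum_secondFF_eq_zero_of_trace_compression_eq_zero b htr

theorem IsIsometricImmersion.thirdFF_comp_eq (hF : IsIsometricImmersion m k F)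
    (hG : IsIsometricImmersion m l G) (hj : IsIsometricImmersion n m j)
    (hFt : traceSecondFF n k (F ∘ j) x ∈ tangentImage m k F (j x))
    (hGt : traceSecondFF n l (G ∘ j) x ∈ tangentImage m l G (j x))
    (X Y : TangentSpace (𝓡 n) x) :
    thirdFF n k (F ∘ j) x X Y = thirdFF n l (G ∘ j) x X Y := by
  have inner_traceSecondFF_eq :
      ⟪traceSecondFF n k (F ∘ j) x, secondFF n k (F ∘ j) x X Y⟫_ℝ =
        ⟪traceSecondFF n l (G ∘ j) x, secondFF n l (G ∘ j) x X Y⟫_ℝ :=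
    inner_eq_inner_of_mem_range (L := hF.differential (j x)) (L' := hG.differential (j x)) hFt hGt
      (fun w => by simp only [traceSecondFF, sum_inner,
        hF.inner_secondFF_comp_differential_eq hG hj])
      (hF.inner_secondFF_comp_differential_eq hG hj X Y)
  linarith [(hF.comp hj).inner_traceSecondFF_sub_thirdFF_eq (hG.comp hj) X Y]

end TracelessCompressions

end GaussMaps

theorem mainTheorem2_general {n m k : ℕ}
    {N : Type*} [TopologicalSpace N] [ChartedSpace (GaussMaps.E m) N] [IsManifold (𝓡 m) ∞ N]
    [RiemannianBundle (fun y : N => TangentSpace (𝓡 m) y)]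
    {M : Type*} [TopologicalSpace M] [ChartedSpace (GaussMaps.E n) M] [IsManifold (𝓡 n) ∞ M]
    [RiemannianBundle (fun x : M => TangentSpace (𝓡 n) x)]
    {F G : N → GaussMaps.E k} (hF : GaussMaps.IsIsometricImmersion m k F)
    (hG : GaussMaps.IsIsometricImmersion m k G)
    {j : M → N} (hj : GaussMaps.IsIsometricImmersion n m j)
    (htrF : ∀ x, ∀ ξ ∈ (GaussMaps.tangentImage m k F (j x))ᗮ, ‖ξ‖ = 1 →
      LinearMap.trace ℝ _ (GaussMaps.compression
        (LinearMap.range (mfderiv (𝓡 n) (𝓡 m) j x).toLinearMap)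
        (GaussMaps.shapeOperator m k F (j x) ξ)) = 0)
    (htrG : ∀ x, ∀ ξ ∈ (GaussMaps.tangentImage m k G (j x))ᗮ, ‖ξ‖ = 1 →
      LinearMap.trace ℝ _ (GaussMaps.compression
        (LinearMap.range (mfderiv (𝓡 n) (𝓡 m) j x).toLinearMap)
        (GaussMaps.shapeOperator m k G (j x) ξ)) = 0) :
    GaussMaps.HaveIsometricGaussMaps n k (F ∘ j) (G ∘ j) ∧
      GaussMaps.HaveEqualThirdFF n k (F ∘ j) (G ∘ j) := by
  have thirdFF_eq : GaussMaps.HaveEqualThirdFF n k (F ∘ j) (G ∘ j) := fun x =>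
    hF.thirdFF_comp_eq hG hj (hF.traceSecondFF_comp_mem_tangentImage hj (htrF x))
      (hG.traceSecondFF_comp_mem_tangentImage hj (htrG x))
  refine ⟨fun x X Y => ?_, thirdFF_eq⟩
  rw [(hF.comp hj).gaussGraphMetric_eq, (hG.comp hj).gaussGraphMetric_eq, thirdFF_eq x X Y]

theorem mainTheorem2 (n : ℕ) (hn : 3 ≤ n)
    -- the Riemannian manifold `M̄ⁿ⁺¹`
    (Mbar : Type*) [TopologicalSpace Mbar] [ChartedSpace (GaussMaps.E (n + 1)) Mbar]
    [IsManifold (𝓡 (n + 1)) ∞ Mbar]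
    [RiemannianBundle (fun y : Mbar => TangentSpace (𝓡 (n + 1)) y)]
    [IsContMDiffRiemannianBundle (𝓡 (n + 1)) ∞ (GaussMaps.E (n + 1))
      (fun y : Mbar => TangentSpace (𝓡 (n + 1)) y)]
    -- the Riemannian manifold `Mⁿ`
    (M : Type*) [TopologicalSpace M] [ChartedSpace (GaussMaps.E n) M]
    [IsManifold (𝓡 n) ∞ M]
    [RiemannianBundle (fun x : M => TangentSpace (𝓡 n) x)]
    [IsContMDiffRiemannianBundle (𝓡 n) ∞ (GaussMaps.E n)
      (fun x : M => TangentSpace (𝓡 n) x)]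
    (F G : Mbar → GaussMaps.E (n + 2))
    (hF : GaussMaps.IsEllipticSbranaCartan (n + 1) F)
    (hG : GaussMaps.IsIsometricImmersion (n + 1) (n + 2) G)
    (j : M → Mbar) (hj : GaussMaps.IsIsometricImmersion n (n + 1) j)
    (htrF : ∀ (x : M) (ξ : GaussMaps.E (n + 2)),
      ξ ∈ (GaussMaps.tangentImage (n + 1) (n + 2) F (j x))ᗮ → ‖ξ‖ = 1 →
        LinearMap.trace ℝ _ (GaussMaps.compression
          (LinearMap.range (mfderiv (𝓡 n) (𝓡 (n + 1)) j x).toLinearMap)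
          (GaussMaps.shapeOperator (n + 1) (n + 2) F (j x) ξ)) = 0)
    (htrG : ∀ (x : M) (ξ : GaussMaps.E (n + 2)),
      ξ ∈ (GaussMaps.tangentImage (n + 1) (n + 2) G (j x))ᗮ → ‖ξ‖ = 1 →
        LinearMap.trace ℝ _ (GaussMaps.compression
          (LinearMap.range (mfderiv (𝓡 n) (𝓡 (n + 1)) j x).toLinearMap)
          (GaussMaps.shapeOperator (n + 1) (n + 2) G (j x) ξ)) = 0) :
    GaussMaps.HaveIsometricGaussMaps n (n + 2) (F ∘ j) (G ∘ j) ∧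
      GaussMaps.HaveEqualThirdFF n (n + 2) (F ∘ j) (G ∘ j) :=
  mainTheorem2_general hF.isometric hG hj htrF htrG
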